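/- Let $\mathbb{F}$ be a field (of arbitrary characteristic), let $n\geq 1$, let $\mathbb{U}_1,\ldots,\mathbb{U}_n$ be finite sets with $|\mathbb{U}_i|\geq 2$ for all $i$, let $\mathbb{X}=\mathbb{U}_1\times\cdots\times\mathbb{U}_n$, and fix $\mathbf{x}\in\mathbb{X}$. Put $d=2^n-1$. For $0\leq g\leq d$ let $\mathbb{P}(g)\subseteq\{1,\ldots,n\}$ be the set of all $i$ such that $2^{i-1}$ occurs in the binary expansion of $g$, and let $R_g$ be the set of all $(\mathbf{a},\mathbf{b})\in\mathbb{X}\times\mathbb{X}$ such that $\{i:\mathbf{a}_i\neq\mathbf{b}_i\}=\mathbb{P}(g)$; these relations form the factorial association scheme on $\mathbb{X}$. In the algebra $\mathrm{M}_{\mathbb{X}}(\mathbb{F})$ of square $\mathbb{F}$-matrices indexed by $\mathbb{X}$, let $A_g$ be the $0/1$-matrix whose $(\mathbf{y},\mathbf{z})$-entry is $1$ if and only if $(\mathbf{y},\mathbf{z})\in R_g$, and let $E_g^*$ be the diagonal $0/1$-matrix whose $(\mathbf{y},\mathbf{y})$-entry is $1$ if and only if $(\mathbf{x},\mathbf{y})\in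 R_g$. Let $\mathbb{T}$ be the unital $\mathbb{F}$-subalgebra of $\mathrm{M}_{\mathbb{X}}(\mathbb{F})$ generated by $E_0^*,\ldots,E_d^*,A_0,\ldots,A_d$ (the Terwilliger $\mathbb{F}$-algebra of the scheme with respect to $\mathbf{x}$), let $\mathrm{Z}(\mathbb{T})$ be its center, and regard $E_d^*\mathbb{T}E_d^*=\{E_d^*ME_d^*: M\in\mathbb{T}\}$ as an algebra with identity element $E_d^*$. Then $\mathbb{T}$ is semisimple if and only if $E_d^*\mathbb{T}E_d^*$ is semisimple. Moreover, $\mathbb{T}$ is semisimple if and only if $\mathrm{Z}(\mathbb{T})$ is semisimple. -/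

import Mathlib

namespace FactorialScheme

/-- `supp n g` is the set of positions of the digit `1` in the binary expansion of `g`
(with `n` digits). The coordinate set `{1, …, n}` is modelled by `Fin n`, so the digit
of the (zero-based) coordinate `k` is the coefficient of `2 ^ k`. -/
def supp (n : ℕ) (g : Fin (2 ^ n)) : Finset (Fin n) :=
  Finset.univ.filter fun k => Nat.testBit (g : ℕ) (k : ℕ) = true

/-- The largest index `d = 2 ^ n - 1`. -/
def top (n : ℕ) : Fin (2 ^ n) :=
  ⟨2 ^ n - 1, Nat.sub_lt (Nat.two_pow_pos n) Nat.one_pos⟩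

/-- The relation `R_g` of the factorial scheme on the product `∏ k, U k`: two tuples are
`R_g`-related iff the coordinates in which they differ are exactly those in `supp n g`. -/
def rel {n : ℕ} (U : Fin n → Type*) (g : Fin (2 ^ n)) (a b : ∀ k, U k) : Prop :=
  ∀ k : Fin n, a k ≠ b k ↔ k ∈ supp n g

end FactorialScheme

namespace Terwilliger

open Classical in
/-- The adjacency matrix over `F` of a relation `R` on `X`. -/
noncomputable def adjacency (F : Type*) [Field F] {X : Type*} (R : X → X → Prop) :
    Matrix X X F :=
  Matrix.of fun y z => if R y z then 1 else 0

open Classical in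
/-- The dual idempotent over `F` of a relation `R` on `X` with respect to a base point `x`:
the diagonal `0/1` matrix with `(y, y)` entry `1` iff `R x y`. -/
noncomputable def dualIdempotent (F : Type*) [Field F] {X : Type*} [DecidableEq X]
    (R : X → X → Prop) (x : X) : Matrix X X F :=
  Matrix.diagonal fun y => if R x y then 1 else 0

/-- The Terwilliger `F`-algebra with respect to the base point `x` of a scheme on `X` whose
relations are `R i`, `i : ι`: the subalgebra of the full matrix algebra generated by all
dual idempotents and all adjacency matrices. -/
noncomputable def algebra (F : Type*) [Field F] {X ι : Type*} [Fintype X] [DecidableEq X]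
    (R : ι → X → X → Prop) (x : X) : Subalgebra F (Matrix X X F) :=
  Algebra.adjoin F
    ((Set.range fun i => dualIdempotent F (R i) x) ∪ (Set.range fun i => adjacency F (R i)))

/-- The dual idempotent of `R i`, as an element of the Terwilliger algebra. -/
noncomputable def dualIdempotentElem (F : Type*) [Field F] {X ι : Type*} [Fintype X]
    [DecidableEq X] (R : ι → X → X → Prop) (x : X) (i : ι) : algebra F R x :=
  ⟨dualIdempotent F (R i) x, Algebra.subset_adjoin (Or.inl ⟨i, rfl⟩)⟩

theorem isIdempotentElem_dualIdempotentElem (F : Type*) [Field F] {X ι : Type*} [Fintype X]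
    [DecidableEq X] (R : ι → X → X → Prop) (x : X) (i : ι) :
    IsIdempotentElem (dualIdempotentElem F R x i) := by
  apply Subtype.ext
  simp [dualIdempotentElem, dualIdempotent]

/-- The corner `E T E` of the Terwilliger algebra `T` at the dual idempotent `E` of `R i`,
a ring whose identity element is `E`. -/
abbrev Corner (F : Type*) [Field F] {X ι : Type*} [Fintype X] [DecidableEq X]
    (R : ι → X → X → Prop) (x : X) (i : ι) : Type _ :=
  (isIdempotentElem_dualIdempotentElem F R x i).Corner

end Terwilliger

/-! Coordinate by coordinate, `𝕋` is generated by pairs `(e k, j k)`: the matrix unit at `x k` and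
the all-one matrix of size `m k = |U k|`, each tensored with identities. Pairs at different
coordinates commute, and the only number that matters is `m k - 1` in `F`. If every `m k - 1` is
invertible, each pair yields 2×2 matrix units and a complementary idempotent, hence a Casimir-type
averaging operator. Averaging a linear projection onto a left ideal over all `k` makes it
`𝕋`-linear, as in Maschke's theorem (`isSemisimpleRing_of_pointedPair`); semisimplicity passes to
corners and to the center. If some `m k = 1` in `F`, then `N = (1 - e k) * j k * (1 - e k)` is
central with square zero, and `N * E_d^* ≠ 0`. So `N` or `N * E_d^*` obstructs semisimplicity of all
three algebras at once (`isSemisimpleRing_iff_of_pointedPair`). -/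

/-! ### Semisimple rings: central nilpotents, corners, centers. -/

/-- A central square-zero element of a semisimple ring vanishes. -/
theorem IsSemisimpleRing.eq_zero_of_central_of_mul_self {R : Type*} [Ring R] [IsSemisimpleRing R]
    {z : R} (hz : ∀ r, r * z = z * r) (h : z * z = 0) : z = 0 := by
  obtain ⟨e, he, hI⟩ := IsSemisimpleRing.ideal_eq_span_idempotent (Ideal.span {z})
  have hez : e ∈ Ideal.span {z} := hI ▸ Ideal.mem_span_singleton_self e
  have hze : z ∈ Ideal.span {e} := hI ▸ Ideal.mem_span_singleton_self z
  obtain ⟨r, rfl⟩ := Ideal.mem_span_singleton'.1 hez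
  obtain ⟨s, hs⟩ := Ideal.mem_span_singleton'.1 hze
  -- The idempotent is `r * z`, and `(r * z) * (r * z) = r * r * (z * z)` by centrality.
  have h0 : r * z = 0 := by
    rw [← he.eq, mul_assoc, ← mul_assoc z r z, ← hz r, mul_assoc r z z, h, mul_zero, mul_zero]
  rw [← hs, h0, mul_zero]

/-- The corner `e R e` is opposite to the endomorphism ring of the left ideal `R e`. -/
def IsIdempotentElem.cornerEquivEnd {R : Type*} [Ring R] {e : R} (he : IsIdempotentElem e) :
    he.Corner ≃+* (Module.End R (Ideal.span {e} : Ideal R))ᵐᵒᵖ where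
  toFun c := MulOpposite.op
    { toFun := fun t => ⟨t.1 * c.1, by
        rw [← ((Subsemigroup.mem_corner_iff he).1 c.2).2, ← mul_assoc]
        exact Ideal.mul_mem_left _ _ (Ideal.mem_span_singleton_self e)⟩
      map_add' := fun a b => Subtype.ext (add_mul _ _ _)
      map_smul' := fun r a => Subtype.ext (mul_assoc _ _ _) }
  -- An endomorphism is determined by the image of the generator `e`; since `e * e = e`, that image
  -- is fixed by `e` on the left.
  invFun f := ⟨(f.unop ⟨e, Ideal.mem_span_singleton_self e⟩).1, by
    refine (Subsemigroup.mem_corner_iff he).2 ⟨?_, ?_⟩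
    · have := f.unop.map_smul e ⟨e, Ideal.mem_span_singleton_self e⟩
      have h2 : e • (⟨e, Ideal.mem_span_singleton_self e⟩ : (Ideal.span {e} : Ideal R)) =
        ⟨e, Ideal.mem_span_singleton_self e⟩ := Subtype.ext he.eq
      rw [h2] at this
      exact (congrArg Subtype.val this).symm
    · obtain ⟨r, hr⟩ := Ideal.mem_span_singleton'.1
        (f.unop ⟨e, Ideal.mem_span_singleton_self e⟩).2
      rw [← hr, mul_assoc, he.eq]⟩
  left_inv c := Subtype.ext ((Subsemigroup.mem_corner_iff he).1 c.2).1
  right_inv f := by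
    apply MulOpposite.unop_injective
    ext ⟨t, ht⟩
    obtain ⟨r, rfl⟩ := Ideal.mem_span_singleton'.1 ht
    have := f.unop.map_smul (r * e) ⟨e, Ideal.mem_span_singleton_self e⟩
    have h2 : (r * e) • (⟨e, Ideal.mem_span_singleton_self e⟩ : (Ideal.span {e} : Ideal R)) =
      ⟨r * e, ht⟩ := Subtype.ext (by simp [mul_assoc, he.eq])
    rw [h2] at this
    exact (congrArg Subtype.val this).symm
  map_mul' a b := by
    apply MulOpposite.unop_injective
    ext t
    exact (mul_assoc _ _ _).symm
  map_add' a b := by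
    apply MulOpposite.unop_injective
    ext t
    exact mul_add _ _ _

theorem IsSemisimpleRing.corner {R : Type*} [Ring R] [IsSemisimpleRing R] {e : R}
    (he : IsIdempotentElem e) : IsSemisimpleRing he.Corner := by
  have : IsSemisimpleRing (Module.End R (Ideal.span {e} : Ideal R)) :=
    IsSemisimpleRing.moduleEnd R _
  exact he.cornerEquivEnd.symm.isSemisimpleRing

/-- The center is Artinian by finite dimension and reduced because central square-zero elements
vanish. -/
theorem IsSemisimpleRing.subalgebraCenter {F R : Type*} [Field F] [Ring R] [Algebra F R]
    [FiniteDimensional F R] [IsSemisimpleRing R] :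
    IsSemisimpleRing (Subalgebra.center F R) := by
  have : IsArtinianRing (Subalgebra.center F R) := IsArtinianRing.of_finite F _
  have : IsReduced (Subalgebra.center F R) := by
    rw [isReduced_iff_pow_one_lt 2 one_lt_two]
    intro z hz
    apply Subtype.ext
    refine IsSemisimpleRing.eq_zero_of_central_of_mul_self
      (fun r => Subalgebra.mem_center_iff.1 z.2 r) ?_
    rw [pow_two] at hz
    exact congrArg Subtype.val hz
  exact IsArtinianRing.isSemisimpleRing_of_isReduced _

/-! ### Pointed pairs and their averaging operator. -/

/-- Elements `e`, `j` of an algebra which satisfy the relations of the matrix unit at a base point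
and the all-one matrix of size `m`. -/
structure PointedPair {F A : Type*} [Field F] [Ring A] [Algebra F A] (m : F) (e j : A) :
    Prop where
  ee : e * e = e
  jj : j * j = m • j
  eje : e * j * e = e
  jej : j * e * j = j

namespace PointedPair

variable {F A : Type*} [Field F] [Ring A] [Algebra F A] {m : F} {e j : A}

theorem map {B : Type*} [Ring B] [Algebra F B] (h : PointedPair m e j) (f : A →ₐ[F] B) :
    PointedPair m (f e) (f j) where
  ee := by rw [← map_mul, h.ee]
  jj := by rw [← map_mul, h.jj, map_smul]
  eje := by rw [← map_mul, ← map_mul, h.eje]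
  jej := by rw [← map_mul, ← map_mul, h.jej]

theorem of_map {B : Type*} [Ring B] [Algebra F B] (f : A →ₐ[F] B) (hf : Function.Injective f)
    (h : PointedPair m (f e) (f j)) : PointedPair m e j where
  ee := hf (by rw [map_mul, h.ee])
  jj := hf (by rw [map_mul, h.jj, map_smul])
  eje := hf (by rw [map_mul, map_mul, h.eje])
  jej := hf (by rw [map_mul, map_mul, h.jej])

/-- The Casimir-type averaging operator of the pair, for `s` inverse to `m - 1`. -/
def avg (s : F) (e j p : A) : A :=
  e * p * e + ((1 - e) * j * e) * p * (s • (e * j * (1 - e))) +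
    (1 - e - s • ((1 - e) * j * (1 - e))) * p * (1 - e - s • ((1 - e) * j * (1 - e)))

/-- Averaging over one pair does not destroy commutation already achieved with the other pairs. -/
theorem commute_avg {s : F} {p c : A} (he : Commute c e) (hj : Commute c j) (hp : Commute c p) :
    Commute c (avg s e j p) := by
  have h1 : Commute c (1 - e) := (Commute.one_right c).sub_right he
  unfold avg
  have h2 : Commute c (1 - e - s • ((1 - e) * j * (1 - e))) :=
    h1.sub_right (((h1.mul_right hj).mul_right h1).smul_right s)
  exact (((he.mul_right hp).mul_right he).add_right
    ((((h1.mul_right hj).mul_right he).mul_right hp).mul_right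
      (((he.mul_right hj).mul_right h1).smul_right s))).add_right
    ((h2.mul_right hp).mul_right h2)

theorem assoc_rules (h : PointedPair m e j) (x : A) :
    e * (e * x) = e * x ∧ j * (j * x) = m • (j * x) ∧ e * (j * e) = e ∧ j * (e * j) = j := by
  refine ⟨?_, ?_, ?_, ?_⟩
  · rw [← mul_assoc, h.ee]
  · rw [← mul_assoc, h.jj, smul_mul_assoc]
  · rw [← mul_assoc, h.eje]
  · rw [← mul_assoc, h.jej]

/-- Here `e, v, u, u * v` are the matrix units `e₁₁, e₁₂, e₂₁, e₂₂` and `f` is the complementary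
idempotent; the formula for `j` is its Peirce decomposition with respect to `e`. -/
theorem units (h : PointedPair m e j) {s : F} (hs : s * (m - 1) = 1) :
    ∃ u v f : A, (∀ p, avg s e j p = e * p * e + u * p * v + f * p * f) ∧
      j = e + u + (m - 1) • v + (m - 1) • (u * v) ∧
      e * u = 0 ∧ u * e = u ∧ e * v = v ∧ v * e = 0 ∧ u * u = 0 ∧ v * v = 0 ∧ v * u = e ∧
      e * f = 0 ∧ f * e = 0 ∧ f * u = 0 ∧ v * f = 0 ∧ f * f = f ∧ e + u * v + f = 1 := by
  have h1 := h.ee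
  have h2 := h.jj
  have hx := h.assoc_rules
  have a1 := fun x => (hx x).1
  have a2 := fun x => (hx x).2.1
  have a5 := (hx 1).2.2.1
  have a6 := (hx 1).2.2.2
  refine ⟨(1 - e) * j * e, s • (e * j * (1 - e)), 1 - e - s • ((1 - e) * j * (1 - e)),
    fun p => rfl, ?_⟩
  refine ⟨?_, ?_, ?_, ?_, ?_, ?_, ?_, ?_, ?_, ?_, ?_, ?_, ?_, ?_⟩ <;>
  simp only [mul_sub, sub_mul, mul_assoc, h1, h2, a1, a2, a5, a6, smul_mul_assoc,
    mul_smul_comm, one_mul, mul_one] <;>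
  match_scalars <;>
  first
  | ring1
  | linear_combination hs
  | linear_combination -hs
  | linear_combination s * hs
  | linear_combination -s * hs

theorem avg_one (h : PointedPair m e j) {s : F} (hs : s * (m - 1) = 1) : avg s e j 1 = 1 := by
  obtain ⟨u, v, f, ha, hj, eu, ue, ev, ve, uu, vv, vu, ef, fe, fu, vf, ff, h1⟩ := h.units hs
  rw [ha, mul_one, mul_one, mul_one, h.ee, ff, h1]

theorem commute_avg_left (h : PointedPair m e j) {s : F} (hs : s * (m - 1) = 1) (p : A) :
    Commute e (avg s e j p) := by
  obtain ⟨u, v, f, ha, hj, eu, ue, ev, ve, uu, vv, vu, ef, fe, fu, vf, ff, h1⟩ := h.units hs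
  rw [ha, Commute, SemiconjBy]
  simp only [mul_add, add_mul, ← mul_assoc, h.ee, eu, ef, zero_mul]
  simp only [mul_assoc, h.ee, ve, fe, mul_zero]

theorem commute_avg_right (h : PointedPair m e j) {s : F} (hs : s * (m - 1) = 1) (p : A) :
    Commute j (avg s e j p) := by
  have he := h.commute_avg_left hs p
  obtain ⟨u, v, f, ha, hj, eu, ue, ev, ve, uu, vv, vu, ef, fe, fu, vf, ff, h1⟩ := h.units hs
  have uf : u * f = 0 := by rw [← ue, mul_assoc, ef, mul_zero]
  have fv : f * v = 0 := by rw [← ev, ← mul_assoc, fe, zero_mul]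
  have hu : Commute u (avg s e j p) := by
    rw [ha, Commute, SemiconjBy]
    simp only [mul_add, add_mul, ← mul_assoc, ue, uu, uf, zero_mul]
    simp only [mul_assoc, eu, vu, fu, mul_zero]
    simp
  have hv : Commute v (avg s e j p) := by
    rw [ha, Commute, SemiconjBy]
    simp only [mul_add, add_mul, ← mul_assoc, ve, vu, vf, zero_mul]
    simp only [mul_assoc, ev, vv, fv, mul_zero]
    simp
  have := ((he.add_left hu).add_left (hv.smul_left (m - 1))).add_left
    ((hu.mul_left hv).smul_left (m - 1))
  rwa [← hj] at this

end PointedPair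

/-! ### Semisimplicity of algebras generated by commuting pointed pairs. -/

/-- An algebra generated by mutually commuting pointed pairs of sizes `m k` with `m k - 1`
invertible is semisimple. -/
theorem isSemisimpleRing_of_pointedPair {F A ι : Type*} [Field F] [Ring A] [Algebra F A]
    [Finite ι] {m s : ι → F} {e j : ι → A} (h : ∀ k, PointedPair (m k) (e k) (j k))
    (hs : ∀ k, s k * (m k - 1) = 1)
    (hcomm : ∀ k l, k ≠ l → ∀ a ∈ ({e k, j k} : Set A), ∀ b ∈ ({e l, j l} : Set A), Commute a b)
    (htop : Algebra.adjoin F (Set.range e ∪ Set.range j) = ⊤) : IsSemisimpleRing A := by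
  classical
  have := Fintype.ofFinite ι
  refine (isSemisimpleModule_iff A A).2 ⟨fun I => ?_⟩
  let L : A →ₐ[F] Module.End F A := Algebra.lmul F A
  have hL := fun k => (h k).map L
  obtain ⟨π, hπ⟩ := (I.restrictScalars F).subtype.exists_leftInverse_of_injective
    (by simp)
  -- `P q`: the linear map `q` is a projection onto `I`. Averaging preserves this because `I` is a
  -- left ideal and the average of the identity is the identity.
  let P : Module.End F A → Prop := fun q => (∀ a, q a ∈ I) ∧ ∀ a ∈ I, q a = a
  have havg : ∀ k q a, PointedPair.avg (s k) (L (e k)) (L (j k)) q a =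
      e k • q (e k • a) + ((1 - e k) * j k * e k) • q ((s k • (e k * j k * (1 - e k))) • a) +
        (1 - e k - s k • ((1 - e k) * j k * (1 - e k))) •
          q ((1 - e k - s k • ((1 - e k) * j k * (1 - e k))) • a) := by
    intro k q a
    have h1 : PointedPair.avg (s k) (L (e k)) (L (j k)) q =
      L (e k) * q * L (e k) +
        L ((1 - e k) * j k * e k) * q * L (s k • (e k * j k * (1 - e k))) +
        L (1 - e k - s k • ((1 - e k) * j k * (1 - e k))) * q *
          L (1 - e k - s k • ((1 - e k) * j k * (1 - e k))) := by
      simp only [map_mul, map_sub, map_one, map_smul, PointedPair.avg]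
    rw [h1]
    rfl
  have key : ∀ S : Finset ι, ∃ q : Module.End F A, P q ∧
      ∀ k ∈ S, Commute (L (e k)) q ∧ Commute (L (j k)) q := by
    intro S
    induction S using Finset.induction_on with
    | empty =>
      refine ⟨(I.restrictScalars F).subtype ∘ₗ π, ⟨fun a => (π a).2, fun a ha => ?_⟩, by simp⟩
      exact congrArg Subtype.val (LinearMap.congr_fun hπ ⟨a, ha⟩)
    | insert k S hk ih =>
      obtain ⟨q, ⟨hq1, hq2⟩, hq⟩ := ih
      refine ⟨PointedPair.avg (s k) (L (e k)) (L (j k)) q, ⟨fun a => ?_, fun a ha => ?_⟩, ?_⟩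
      · rw [havg]
        exact I.add_mem (I.add_mem (I.smul_mem _ (hq1 _)) (I.smul_mem _ (hq1 _)))
          (I.smul_mem _ (hq1 _))
      · have h1 := havg k 1 a
        rw [(hL k).avg_one (hs k)] at h1
        rw [havg, hq2 _ (I.smul_mem _ ha), hq2 _ (I.smul_mem _ ha), hq2 _ (I.smul_mem _ ha)]
        exact h1.symm
      · intro l hl
        rcases Finset.mem_insert.1 hl with rfl | hl
        · exact ⟨(hL l).commute_avg_left (hs l) q, (hL l).commute_avg_right (hs l) q⟩
        · have hne : l ≠ k := fun h => hk (h ▸ hl)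
          have hc := fun a ha b hb => (hcomm l k hne a ha b hb).map L
          exact ⟨PointedPair.commute_avg (hc _ (by simp) _ (by simp)) (hc _ (by simp) _ (by simp))
              (hq l hl).1,
            PointedPair.commute_avg (hc _ (by simp) _ (by simp)) (hc _ (by simp) _ (by simp))
              (hq l hl).2⟩
  obtain ⟨q, ⟨hq1, hq2⟩, hq⟩ := key Finset.univ
  have hall : ∀ a, Commute (L a) q := by
    intro a
    have ha : a ∈ Algebra.adjoin F (Set.range e ∪ Set.range j) := htop ▸ Algebra.mem_top
    have hle : Algebra.adjoin F (Set.range e ∪ Set.range j) ≤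
        (Subalgebra.centralizer F {q}).comap L := by
      rw [Algebra.adjoin_le_iff]
      rintro _ (⟨k, rfl⟩ | ⟨k, rfl⟩)
      · exact (Subalgebra.mem_centralizer_iff F).2
          (by simpa using (hq k (Finset.mem_univ k)).1.symm.eq)
      · exact (Subalgebra.mem_centralizer_iff F).2
          (by simpa using (hq k (Finset.mem_univ k)).2.symm.eq)
    have := hle ha
    simp only [Subalgebra.mem_comap, Subalgebra.mem_centralizer_iff, Set.mem_singleton_iff,
      forall_eq] at this
    exact this.symm
  let Q : A →ₗ[A] I :=
    { toFun := fun a => ⟨q a, hq1 a⟩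
      map_add' := fun a b => Subtype.ext (map_add q a b)
      map_smul' := fun a b => Subtype.ext (LinearMap.congr_fun (hall a).eq b).symm }
  exact ⟨LinearMap.ker Q, LinearMap.isCompl_of_proj fun x => Subtype.ext (hq2 x x.2)⟩

/-- If `m = 1`, then `(1 - e) j (1 - e)` is annihilated by `e`, `j` and itself. -/
theorem PointedPair.mul_eq_zero {F A : Type*} [Field F] [Ring A] [Algebra F A] {e j : A}
    (h : PointedPair (1 : F) e j) :
    e * ((1 - e) * j * (1 - e)) = 0 ∧ (1 - e) * j * (1 - e) * e = 0 ∧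
      j * ((1 - e) * j * (1 - e)) = 0 ∧ (1 - e) * j * (1 - e) * j = 0 := by
  have h1 := h.ee
  have h2 := h.jj
  have hx := h.assoc_rules
  have a1 := fun x => (hx x).1
  have a2 := fun x => (hx x).2.1
  have a3 := (hx 1).2.2.1
  have a4 := (hx 1).2.2.2
  refine ⟨?_, ?_, ?_, ?_⟩ <;>
  simp [mul_sub, sub_mul, mul_assoc, h1, h2, a1, a2, a3, a4]

/-- For an algebra generated by mutually commuting pointed pairs, semisimplicity is detected on
the center and on any corner which is not annihilated by the nilpotent central elements
attached to pairs with `m k = 1`. -/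
theorem isSemisimpleRing_iff_of_pointedPair {F A ι : Type*} [Field F] [Ring A] [Algebra F A]
    [FiniteDimensional F A] [Finite ι] {m : ι → F} {e j : ι → A}
    (h : ∀ k, PointedPair (m k) (e k) (j k))
    (hcomm : ∀ k l, k ≠ l → ∀ a ∈ ({e k, j k} : Set A), ∀ b ∈ ({e l, j l} : Set A), Commute a b)
    (htop : Algebra.adjoin F (Set.range e ∪ Set.range j) = ⊤) {E : A} (hE : IsIdempotentElem E)
    (hne : ∀ k, m k = 1 → (1 - e k) * j k * (1 - e k) * E ≠ 0) :
    (IsSemisimpleRing A ↔ IsSemisimpleRing hE.Corner) ∧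
      (IsSemisimpleRing A ↔ IsSemisimpleRing (Subalgebra.center F A)) := by
  by_cases hm : ∃ k, m k = 1
  · obtain ⟨k, hk⟩ := hm
    set N := (1 - e k) * j k * (1 - e k) with hN
    have hp := h k
    rw [hk] at hp
    obtain ⟨z1, z2, z3, z4⟩ := hp.mul_eq_zero
    rw [← hN] at z1 z2 z3 z4
    -- `N` absorbs `1 - e k` on the right and is killed by `j k`.
    have hNN : N * N = 0 := by
      nth_rewrite 2 [hN]
      have h1 : N * (1 - e k) = N := by rw [mul_sub, mul_one, z2, sub_zero]
      rw [← mul_assoc, ← mul_assoc, h1, z4, zero_mul]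
    have hN0 : N ≠ 0 := fun h0 => hne k hk (by rw [← hN, h0, zero_mul])
    have hgen : ∀ l, Commute (e l) N ∧ Commute (j l) N := by
      intro l
      by_cases hlk : l = k
      · subst hlk
        exact ⟨z1.trans z2.symm, z3.trans z4.symm⟩
      · have hc := hcomm l k hlk
        have aux : ∀ a ∈ ({e l, j l} : Set A), Commute a N := fun a ha => by
          have c1 : Commute a (1 - e k) :=
            (Commute.one_right a).sub_right (hc a ha _ (by simp))
          exact (c1.mul_right (hc a ha _ (by simp))).mul_right c1
        exact ⟨aux _ (by simp), aux _ (by simp)⟩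
    have hcen : ∀ a, a * N = N * a := by
      intro a
      have ha : a ∈ Algebra.adjoin F (Set.range e ∪ Set.range j) := htop ▸ Algebra.mem_top
      have hle : Algebra.adjoin F (Set.range e ∪ Set.range j) ≤ Subalgebra.centralizer F {N} := by
        rw [Algebra.adjoin_le_iff]
        rintro _ (⟨l, rfl⟩ | ⟨l, rfl⟩)
        · exact (Subalgebra.mem_centralizer_iff F).2 (by simpa using (hgen l).1.symm.eq)
        · exact (Subalgebra.mem_centralizer_iff F).2 (by simpa using (hgen l).2.symm.eq)
      exact ((Subalgebra.mem_centralizer_iff F).1 (hle ha) N rfl).symm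
    have hNE : N * E ≠ 0 := hne k hk
    clear_value N
    have n1 : ¬ IsSemisimpleRing A := fun _ =>
      hN0 (IsSemisimpleRing.eq_zero_of_central_of_mul_self hcen hNN)
    have n2 : ¬ IsSemisimpleRing hE.Corner := by
      intro _
      have hmem : N * E ∈ Subsemigroup.corner E :=
        (Subsemigroup.mem_corner_iff hE).2
          ⟨by rw [← mul_assoc, hcen, mul_assoc, hE.eq], by rw [mul_assoc, hE.eq]⟩
      let c : hE.Corner := ⟨N * E, hmem⟩
      have h0 : c = 0 := by
        refine IsSemisimpleRing.eq_zero_of_central_of_mul_self ?_ (Subtype.ext ?_)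
        · rintro ⟨r, hr⟩
          rw [Subsemigroup.mem_corner_iff hE] at hr
          refine Subtype.ext ?_
          change r * (N * E) = N * E * r
          rw [mul_assoc, hr.1, ← mul_assoc, hcen, mul_assoc, hr.2]
        · change N * E * (N * E) = 0
          rw [mul_assoc, ← mul_assoc E, hcen, mul_assoc N E E, ← mul_assoc, hNN, zero_mul]
      exact hNE (congrArg Subtype.val h0)
    have n3 : ¬ IsSemisimpleRing (Subalgebra.center F A) := by
      intro _
      have h0 : (⟨N, Subalgebra.mem_center_iff.2 hcen⟩ : Subalgebra.center F A) = 0 :=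
        IsSemisimpleRing.eq_zero_of_central_of_mul_self (fun r => mul_comm _ _)
          (Subtype.ext hNN)
      exact hN0 (congrArg Subtype.val h0)
    exact ⟨iff_of_false n1 n2, iff_of_false n1 n3⟩
  · push Not at hm
    have hA : IsSemisimpleRing A := isSemisimpleRing_of_pointedPair
      (s := fun k => (m k - 1)⁻¹) h (fun k => inv_mul_cancel₀ (sub_ne_zero.2 (hm k))) hcomm htop
    exact ⟨iff_of_true hA (IsSemisimpleRing.corner hE),
      iff_of_true hA IsSemisimpleRing.subalgebraCenter⟩

/-! ### Coordinate matrices of the factorial scheme. -/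

namespace FactorialScheme

set_option linter.unusedSectionVars false

section CoordinateMatrices

variable (F : Type*) [Field F] {ι : Type*} [Fintype ι] [DecidableEq ι] {U : ι → Type*}
  [∀ k, Fintype (U k)] [∀ k, DecidableEq (U k)]

/-- The diagonal matrix of the tuples which agree with the base point `x` at `k`. -/
def baseMatrix (x : ∀ k, U k) (k : ι) : Matrix (∀ k, U k) (∀ k, U k) F :=
  Matrix.diagonal fun y => if y k = x k then 1 else 0

/-- The matrix of the relation "equal outside the coordinate `k`". -/
def fiberMatrix (U : ι → Type*) [∀ k, DecidableEq (U k)] (k : ι) :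
    Matrix (∀ k, U k) (∀ k, U k) F :=
  Matrix.of fun y z => if ∀ l, l ≠ k → y l = z l then 1 else 0

/-- The matrix of the relation "differ exactly in the coordinates of `S`". -/
def diffMatrix (U : ι → Type*) [∀ k, DecidableEq (U k)] (S : Finset ι) :
    Matrix (∀ k, U k) (∀ k, U k) F :=
  Matrix.of fun y z => if ∀ l, y l ≠ z l ↔ l ∈ S then 1 else 0

variable {F}

/-- The tuples agreeing with `y` off `k` are parametrized by their `k`-th entry. -/
theorem sum_fiber (k : ι) (y : ∀ k, U k) (f : (∀ k, U k) → F) :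
    (∑ w, if ∀ l, l ≠ k → y l = w l then f w else 0) = ∑ a, f (Function.update y k a) := by
  rw [← Finset.sum_filter]
  symm
  refine Finset.sum_bij' (fun a _ => Function.update y k a) (fun w _ => w k) ?_ ?_ ?_ ?_ ?_
  · intro a _
    simp only [Finset.mem_filter, Finset.mem_univ, true_and]
    intro l hl
    simp [hl]
  · simp
  · simp
  · intro w hw
    simp only [Finset.mem_filter, Finset.mem_univ, true_and] at hw
    funext l
    by_cases hl : l = k
    · subst hl; simp
    · simp [hl, hw l hl]
  · simp

theorem fiberMatrix_mul_apply (k : ι) (M : Matrix (∀ k, U k) (∀ k, U k) F) (y z : ∀ k, U k) :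
    (fiberMatrix F U k * M) y z = ∑ a, M (Function.update y k a) z := by
  rw [← sum_fiber k y (fun w => M w z), Matrix.mul_apply]
  simp [fiberMatrix]

theorem mul_fiberMatrix_apply (k : ι) (M : Matrix (∀ k, U k) (∀ k, U k) F) (y z : ∀ k, U k) :
    (M * fiberMatrix F U k) y z = ∑ a, M y (Function.update z k a) := by
  rw [← sum_fiber k z (fun w => M y w), Matrix.mul_apply]
  simp [fiberMatrix, eq_comm]

theorem update_fiber {k : ι} {y z : ∀ k, U k} (a : U k) :
    (∀ l, l ≠ k → Function.update y k a l = z l) ↔ ∀ l, l ≠ k → y l = z l := by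
  refine forall_congr' fun l => forall_congr' fun hl => ?_
  rw [Function.update_of_ne hl]

theorem pointedPair (x : ∀ k, U k) (k : ι) :
    PointedPair (Fintype.card (U k) : F) (baseMatrix F x k) (fiberMatrix F U k) where
  ee := by simp [baseMatrix]
  jj := by
    ext y z
    rw [fiberMatrix_mul_apply]
    simp [fiberMatrix, update_fiber]
  eje := by
    ext y z
    simp only [baseMatrix, fiberMatrix, Matrix.mul_diagonal, Matrix.diagonal_mul,
      Matrix.diagonal_apply, Matrix.of_apply]
    by_cases hyz : y = z
    · subst hyz; simp
    · have : ¬ ((y k = x k ∧ z k = x k) ∧ ∀ l, l ≠ k → y l = z l) := by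
        rintro ⟨⟨h1, h2⟩, h3⟩
        apply hyz
        funext l
        by_cases hl : l = k
        · subst hl; rw [h1, h2]
        · exact h3 l hl
      grind
  jej := by
    ext y z
    rw [mul_assoc, fiberMatrix_mul_apply]
    simp [baseMatrix, fiberMatrix, update_fiber, Matrix.diagonal_mul]

theorem commute_baseMatrix (x : ∀ k, U k) (k l : ι) :
    Commute (baseMatrix F x k) (baseMatrix F x l) := by
  simp [baseMatrix, Commute, SemiconjBy, mul_comm]

theorem commute_baseMatrix_fiberMatrix (x : ∀ k, U k) {k l : ι} (h : k ≠ l) :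
    Commute (baseMatrix F x k) (fiberMatrix F U l) := by
  ext y z
  simp only [baseMatrix, fiberMatrix, Matrix.mul_diagonal, Matrix.diagonal_mul, Matrix.of_apply]
  by_cases hyz : ∀ i, i ≠ l → y i = z i
  · rw [if_pos hyz, hyz k h, mul_one, one_mul]
  · rw [if_neg hyz, mul_zero, zero_mul]

theorem commute_fiberMatrix (k l : ι) :
    Commute (fiberMatrix F U k) (fiberMatrix F U l) := by
  by_cases h : k = l
  · rw [h]
  ext y z
  rw [fiberMatrix_mul_apply, mul_fiberMatrix_apply]
  have key : ∀ (y z : ∀ k, U k) (a : U k), (∀ i, i ≠ l → Function.update y k a i = z i) ↔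
      a = z k ∧ ∀ i, i ≠ l → i ≠ k → y i = z i := by
    intro y z a
    constructor
    · intro H
      refine ⟨by simpa using H k h, fun i hi hk => ?_⟩
      simpa [hk] using H i hi
    · rintro ⟨h1, h2⟩ i hi
      by_cases hk : i = k
      · subst hk; simpa using h1
      · simpa [hk] using h2 i hi hk
  have e1 : ∀ a, fiberMatrix F U l (Function.update y k a) z =
      if a = z k then (if ∀ i, i ≠ l → i ≠ k → y i = z i then 1 else 0) else 0 := by
    intro a
    simp only [fiberMatrix, Matrix.of_apply, key, ite_and]
  have e2 : ∀ a, fiberMatrix F U l y (Function.update z k a) =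
      if a = y k then (if ∀ i, i ≠ l → i ≠ k → y i = z i then 1 else 0) else 0 := by
    intro a
    have := key z y a
    simp only [eq_comm (b := y _)] at this
    simp only [fiberMatrix, Matrix.of_apply]
    grind
  simp [e1, e2]

theorem diffMatrix_empty : diffMatrix F U ∅ = 1 := by
  ext y z
  simp [diffMatrix, Matrix.one_apply, funext_iff]

/-- `fiberMatrix F U k - 1` is the relation "differ exactly at `k`", so each adjacency matrix is a
product of such factors. -/
theorem diffMatrix_insert {k : ι} {S : Finset ι} (hk : k ∉ S) :
    diffMatrix F U (insert k S) = (fiberMatrix F U k - 1) * diffMatrix F U S := by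
  ext y z
  rw [sub_mul, one_mul, Matrix.sub_apply, fiberMatrix_mul_apply]
  -- As `k ∉ S`, only the term `a = z k` of the fiber sum survives.
  have key : ∀ a, (∀ i, Function.update y k a i ≠ z i ↔ i ∈ S) ↔
      a = z k ∧ ∀ i, i ≠ k → (y i ≠ z i ↔ i ∈ S) := by
    intro a
    constructor
    · intro H
      refine ⟨by simpa [hk] using H k, fun i hi => ?_⟩
      simpa [hi] using H i
    · rintro ⟨h1, h2⟩ i
      by_cases hi : i = k
      · subst hi; simpa [hk] using h1
      · simpa [hi] using h2 i hi
  have e1 : ∀ a, diffMatrix F U S (Function.update y k a) z =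
      if a = z k then (if ∀ i, i ≠ k → (y i ≠ z i ↔ i ∈ S) then 1 else 0) else 0 := by
    intro a
    simp only [diffMatrix, Matrix.of_apply, key, ite_and]
  have e2 : (∀ i, y i ≠ z i ↔ i ∈ S) ↔ y k = z k ∧ ∀ i, i ≠ k → (y i ≠ z i ↔ i ∈ S) := by
    simpa using key (y k)
  have e3 : (∀ i, y i ≠ z i ↔ i ∈ insert k S) ↔
      y k ≠ z k ∧ ∀ i, i ≠ k → (y i ≠ z i ↔ i ∈ S) := by
    grind
  simp only [e1, Finset.sum_ite_eq', Finset.mem_univ, if_true]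
  simp only [diffMatrix, Matrix.of_apply, e2, e3]
  by_cases h1 : y k = z k <;> simp [h1]

theorem diffMatrix_mem {B : Subalgebra F (Matrix (∀ k, U k) (∀ k, U k) F)}
    (hB : ∀ k, fiberMatrix F U k ∈ B) (S : Finset ι) : diffMatrix F U S ∈ B := by
  induction S using Finset.induction_on with
  | empty => rw [diffMatrix_empty]; exact one_mem B
  | insert k S hk ih =>
    rw [diffMatrix_insert hk]
    exact mul_mem (sub_mem (hB k) (one_mem B)) ih

theorem fiberMatrix_eq (k : ι) :
    fiberMatrix F U k = diffMatrix F U ∅ + diffMatrix F U {k} := by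
  have := diffMatrix_insert (F := F) (U := U) (Finset.notMem_empty k)
  rw [diffMatrix_empty, mul_one] at this
  rw [diffMatrix_empty, ← insert_empty_eq, this]
  abel

theorem diagonal_diff_mem {B : Subalgebra F (Matrix (∀ k, U k) (∀ k, U k) F)} (x : ∀ k, U k)
    (hB : ∀ k, baseMatrix F x k ∈ B) (S : Finset ι) :
    (Matrix.diagonal fun y => if ∀ k, x k ≠ y k ↔ k ∈ S then (1 : F) else 0) ∈ B := by
  have h1 : (fun y : ∀ k, U k => if ∀ k, x k ≠ y k ↔ k ∈ S then (1 : F) else 0) =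
      ∏ k, fun y => if x k ≠ y k ↔ k ∈ S then (1 : F) else 0 := by
    funext y
    rw [Finset.prod_apply, Finset.prod_ite_zero]
    simp
  rw [h1]
  -- Pulling back to the commutative algebra of functions gives sense to the product; its factors
  -- are `1 - e k` for `k ∈ S` and `e k` otherwise.
  have h2 : (∏ k, fun y : (∀ k, U k) => if x k ≠ y k ↔ k ∈ S then (1 : F) else 0) ∈
      B.comap (Matrix.diagonalAlgHom F) := by
    refine prod_mem fun k _ => ?_
    have hk : (fun y : ∀ k, U k => if y k = x k then (1 : F) else 0) ∈
      B.comap (Matrix.diagonalAlgHom F) := hB k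
    by_cases hS : k ∈ S
    · convert sub_mem (one_mem _) hk using 1
      funext y
      by_cases hy : y k = x k <;> simp [hS, hy, eq_comm (a := x k)]
    · convert hk using 1
      funext y
      by_cases hy : y k = x k <;> simp [hS, hy, eq_comm (a := x k)]
  exact h2

end CoordinateMatrices

/-! ### From binary indices to coordinates; the Terwilliger algebra. -/

theorem supp_bijective (n : ℕ) : Function.Bijective (supp n) := by
  rw [Fintype.bijective_iff_injective_and_card]
  refine ⟨fun g h hgh => Fin.ext (Nat.eq_of_testBit_eq fun i => ?_), by simp⟩
  by_cases hi : i < n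
  · have := Finset.ext_iff.1 hgh ⟨i, hi⟩
    simp only [supp, Finset.mem_filter, Finset.mem_univ, true_and] at this
    exact Bool.eq_iff_iff.2 this
  · have hle : 2 ^ n ≤ 2 ^ i := Nat.pow_le_pow_right two_pos (not_lt.1 hi)
    rw [Nat.testBit_lt_two_pow (g.2.trans_le hle), Nat.testBit_lt_two_pow (h.2.trans_le hle)]

theorem mem_supp_top (n : ℕ) (k : Fin n) : k ∈ supp n (top n) := by
  simp [supp, top]

section Terwilliger

variable {F : Type*} [Field F] {n : ℕ} {U : Fin n → Type*} [∀ k, Fintype (U k)]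
  [∀ k, DecidableEq (U k)]

theorem adjacency_rel (g : Fin (2 ^ n)) :
    Terwilliger.adjacency F (rel U g) = diffMatrix F U (supp n g) := by
  ext y z
  simp only [Terwilliger.adjacency, diffMatrix, rel, Matrix.of_apply]
  congr

theorem dualIdempotent_rel (x : ∀ k, U k) (g : Fin (2 ^ n)) :
    Terwilliger.dualIdempotent F (rel U g) x =
      Matrix.diagonal fun y => if ∀ k, x k ≠ y k ↔ k ∈ supp n g then (1 : F) else 0 := by
  simp only [Terwilliger.dualIdempotent, rel]
  congr 1
  funext y
  congr

/-- Each `y` lies in exactly one relation with `x`, and `y k = x k` means that its index omits `k`.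
-/
theorem baseMatrix_eq_sum (x : ∀ k, U k) (k : Fin n) :
    baseMatrix F x k = ∑ g ∈ Finset.univ.filter (fun g => k ∉ supp n g),
      Terwilliger.dualIdempotent F (rel U g) x := by
  ext y z
  rw [Matrix.sum_apply]
  by_cases hyz : y = z
  · subst hyz
    obtain ⟨g, hg⟩ := (supp_bijective n).2 (Finset.univ.filter fun l => x l ≠ y l)
    have h1 : ∀ g', (∀ l, x l ≠ y l ↔ l ∈ supp n g') ↔ g' = g := by
      intro g'
      rw [← (supp_bijective n).1.eq_iff, hg, Finset.ext_iff]
      simp [iff_comm]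
    have h2 : k ∉ supp n g ↔ y k = x k := by simp [hg, eq_comm]
    simp only [dualIdempotent_rel, baseMatrix, Matrix.diagonal_apply_eq, h1]
    simp [h2]
  · simp [dualIdempotent_rel, baseMatrix, hyz]

theorem algebra_rel_eq_adjoin (x : ∀ k, U k) :
    Terwilliger.algebra F (rel U) x =
      Algebra.adjoin F (Set.range (baseMatrix F x) ∪ Set.range (fiberMatrix F U)) := by
  apply le_antisymm
  · refine Algebra.adjoin_le ?_
    rintro _ (⟨g, rfl⟩ | ⟨g, rfl⟩)
    · simp only [dualIdempotent_rel, SetLike.mem_coe]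
      have hB : ∀ k, baseMatrix F x k ∈ Algebra.adjoin F
          (Set.range (baseMatrix F x) ∪ Set.range (fiberMatrix F U)) := fun k =>
        Algebra.subset_adjoin (Or.inl ⟨k, rfl⟩)
      convert diagonal_diff_mem x hB (supp n g)
    · simp only [adjacency_rel]
      exact diffMatrix_mem (fun k => Algebra.subset_adjoin (Or.inr ⟨k, rfl⟩)) _
  · refine Algebra.adjoin_le ?_
    rintro _ (⟨k, rfl⟩ | ⟨k, rfl⟩)
    · rw [baseMatrix_eq_sum]
      refine sum_mem fun g _ => ?_
      exact Algebra.subset_adjoin (Set.mem_union_left _ (Set.mem_range_self g))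
    · rw [fiberMatrix_eq]
      have h : ∀ S, diffMatrix F U S ∈ Terwilliger.algebra F (rel U) x := fun S => by
        obtain ⟨g, rfl⟩ := (supp_bijective n).2 S
        rw [← adjacency_rel]
        exact Algebra.subset_adjoin (Set.mem_union_right _ (Set.mem_range_self g))
      exact add_mem (h _) (h _)

theorem nilpotent_mul_dualIdempotent_ne_zero (hU : ∀ k, 2 ≤ Fintype.card (U k)) (x : ∀ k, U k)
    (k : Fin n) :
    (1 - baseMatrix F x k) * fiberMatrix F U k * (1 - baseMatrix F x k) *
      Terwilliger.dualIdempotent F (rel U (top n)) x ≠ 0 := by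
  have hy : ∀ l, ∃ a : U l, a ≠ x l := fun l =>
    have := Fintype.one_lt_card_iff_nontrivial.1 (hU l)
    exists_ne (x l)
  choose y hy using hy
  intro h0
  have h1 : (1 : Matrix (∀ k, U k) (∀ k, U k) F) - baseMatrix F x k =
      Matrix.diagonal fun y => if y k = x k then 0 else 1 := by
    rw [← Matrix.diagonal_one, baseMatrix, Matrix.diagonal_sub]
    congr 1
    funext y
    split_ifs <;> simp
  -- Since `y` differs from `x` everywhere, this diagonal entry is `1`.
  have := congrFun (congrFun h0 y) y
  rw [h1, dualIdempotent_rel, Matrix.mul_diagonal, Matrix.mul_diagonal, Matrix.diagonal_mul] at this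
  simp [hy, fun l => (hy l).symm, fiberMatrix, mem_supp_top] at this

theorem isSemisimpleRing_algebra_rel_iff (hU : ∀ k, 2 ≤ Fintype.card (U k)) (x : ∀ k, U k) :
    (IsSemisimpleRing (Terwilliger.algebra F (rel U) x) ↔
      IsSemisimpleRing
        (Terwilliger.Corner F (rel U) x (top n))) ∧
    (IsSemisimpleRing (Terwilliger.algebra F (rel U) x) ↔
      IsSemisimpleRing
        (Subalgebra.center F (Terwilliger.algebra F (rel U) x))) := by
  have hT := algebra_rel_eq_adjoin (F := F) x
  have hb : ∀ k, baseMatrix F x k ∈ Terwilliger.algebra F (rel U) x := fun k =>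
    hT ▸ Algebra.subset_adjoin (Or.inl ⟨k, rfl⟩)
  have hf : ∀ k, fiberMatrix F U k ∈ Terwilliger.algebra F (rel U) x := fun k =>
    hT ▸ Algebra.subset_adjoin (Or.inr ⟨k, rfl⟩)
  let e : Fin n → Terwilliger.algebra F (rel U) x := fun k => ⟨baseMatrix F x k, hb k⟩
  let j : Fin n → Terwilliger.algebra F (rel U) x := fun k => ⟨fiberMatrix F U k, hf k⟩
  refine isSemisimpleRing_iff_of_pointedPair (m := fun k => (Fintype.card (U k) : F))
    (e := e) (j := j)
    (fun k => PointedPair.of_map (Terwilliger.algebra F (rel U) x).val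
      Subtype.val_injective (pointedPair x k)) ?_ ?_ _ ?_
  · intro k l hkl a ha b hb
    apply Subtype.ext
    rcases ha with rfl | rfl <;> rcases hb with rfl | rfl
    · exact commute_baseMatrix x k l
    · exact commute_baseMatrix_fiberMatrix x hkl
    · exact (commute_baseMatrix_fiberMatrix x hkl.symm).symm
    · exact commute_fiberMatrix k l
  · rw [eq_top_iff]
    rintro ⟨t, ht⟩ -
    -- Generation inside the subalgebra is checked after embedding into the matrix algebra.
    have hmap : (Algebra.adjoin F (Set.range e ∪ Set.range j)).map
        (Terwilliger.algebra F (rel U) x).val =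
          Terwilliger.algebra F (rel U) x := by
      rw [← Algebra.adjoin_image, Set.image_union, ← Set.range_comp, ← Set.range_comp]
      exact hT.symm
    obtain ⟨u, hu, hut⟩ := hmap.symm ▸ ht
    have : u = ⟨t, ht⟩ := Subtype.ext hut
    exact this ▸ hu
  · intro k _ h0
    exact nilpotent_mul_dualIdempotent_ne_zero hU x k (congrArg Subtype.val h0)

end Terwilliger

end FactorialScheme

theorem corollary6p19 {F : Type*} [Field F] {n : ℕ} (hn : 1 ≤ n)
    (U : Fin n → Type*) [∀ k, Fintype (U k)] [∀ k, DecidableEq (U k)]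
    (hU : ∀ k, 2 ≤ Fintype.card (U k)) (x : ∀ k, U k) :
    (IsSemisimpleRing (Terwilliger.algebra F (FactorialScheme.rel U) x) ↔
      IsSemisimpleRing
        (Terwilliger.Corner F (FactorialScheme.rel U) x (FactorialScheme.top n))) ∧
    (IsSemisimpleRing (Terwilliger.algebra F (FactorialScheme.rel U) x) ↔
      IsSemisimpleRing
        (Subalgebra.center F (Terwilliger.algebra F (FactorialScheme.rel U) x))) :=
  FactorialScheme.isSemisimpleRing_algebra_rel_iff hU x
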